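/- Let $C_2=\{e,\sigma\}$. A $C_2$-representation is a finite-dimensional real inner product space with an action of $C_2$ by linear isometries; $\mathbb R^\alpha$ denotes the one-dimensional trivial or sign representation, and $\oplus$ is the orthogonal direct sum. For $C_2$-representations $U,V,W$ let $\mathcal L(U,V)$ be the space of all (not necessarily equivariant) linear isometries $U\to V$, and let $$\gamma_W(U,V)=\{(f,x): f\in\mathcal L(U,V),\ x\in W\otimes f(U)^\perp\}\subseteq \mathrm{Hom}(U,V)\times (W\otimes V),\qquad \sigma(f,x)=(\sigma f\sigma,\sigma x),$$ be the complement bundle over $\mathcal L(U,V)$, where $C_2$ acts diagonally on $W\otimes V$. Let $J_W(U,V)$ be its Thom space, i.e. (as $\mathcal L(U,V)$ is compact) the one-point compactification of $\gamma_W(U,V)$, a $C_2$-space based at $\infty$. The maps $\gamma_W(V,X)\times\gamma_W(U,V)\to\gamma_W(U,X)$, $((f,x),(g,y))\mapsto (f\circ g,\ x+(\mathrm{id}\otimes f)(y))$, induce composition maps $J_W(V,X)\wedge J_W(U,V)\to J_W(U,X)$ of pointed $C_2$-spaces. Let $S^{W\otimes\mathbb R^\alpha}$ be the one-point compactification of $W\otimes\mathbb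 R^\alpha$, based at $\infty$, let $i:U\to U\oplus\mathbb R^\alpha$ be the standard inclusion, and let $S^{W\otimes\mathbb R^\alpha}\to J_W(U,U\oplus\mathbb R^\alpha)$ be the pointed $C_2$-map $x\mapsto (i,x)$, where $W\otimes\mathbb R^\alpha$ is regarded as $W\otimes i(U)^\perp$. **Proposition.** Let $U,V,W$ be $C_2$-representations and let $\mathbb R^\alpha$ be the trivial or the sign representation. 1. The map $S^{W\otimes\mathbb R^\alpha}\to J_W(U,U\oplus\mathbb R^\alpha)$ is a homeomorphism onto its image, which is the union of $\{\infty\}$ and the closure of the subspace of pairs $(i,x)$; if $W\neq 0$, the image is this closure itself. 2. The homotopy cofibre (reduced mapping cone) of the composition map restricted along this embedding, $$J_W(U\oplus\mathbb R^\alpha,V)\wedge S^{W\otimes\mathbb R^\alpha}\longrightarrow J_W(U,V),$$ is $C_2$-equivariantly homeomorphic, by a base point preserving homeomorphism, to $J_{W\oplus\mathbb R^\alpha}(U,V)$. -/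

import Mathlib

open scoped TensorProduct unitInterval InnerProductSpace

namespace C2Calculus

/-! ### Pointed `C₂`-spaces -/

/-- The cyclic group of order two, written multiplicatively. -/
abbrev C2 : Type := Multiplicative (ZMod 2)

/-- A pointed topological space with a continuous action of `C₂` that fixes the base point. -/
structure PtdC2Space where
  carrier : Type*
  [top : TopologicalSpace carrier]
  pt : carrier
  act : C2 → carrier → carrier
  act_one : ∀ x, act 1 x = x
  act_mul : ∀ g h x, act (g * h) x = act g (act h x)
  continuous_act : ∀ g, Continuous (act g)
  act_pt : ∀ g, act g pt = pt

attribute [instance] PtdC2Space.top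

instance : CoeSort PtdC2Space (Type _) := ⟨PtdC2Space.carrier⟩

/-- Base point preserving `C₂`-equivariant continuous maps. -/
structure PtdC2Hom (X Y : PtdC2Space) where
  toFun : X → Y
  continuous_toFun : Continuous toFun
  map_pt : toFun X.pt = Y.pt
  map_act : ∀ g x, toFun (X.act g x) = Y.act g (toFun x)

/-- Base point preserving `C₂`-equivariant homeomorphisms. -/
structure PtdC2Homeo (X Y : PtdC2Space) extends X.carrier ≃ₜ Y.carrier where
  map_pt : toFun X.pt = Y.pt
  map_act : ∀ g x, toFun (X.act g x) = Y.act g (toFun x)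

/-- The identity map. -/
def PtdC2Hom.id (X : PtdC2Space) : PtdC2Hom X X where
  toFun x := x
  continuous_toFun := continuous_id
  map_pt := rfl
  map_act _ _ := rfl

/-- Composition `g ∘ f`. -/
def PtdC2Hom.comp {X Y Z : PtdC2Space} (g : PtdC2Hom Y Z) (f : PtdC2Hom X Y) : PtdC2Hom X Z where
  toFun x := g.toFun (f.toFun x)
  continuous_toFun := g.continuous_toFun.comp f.continuous_toFun
  map_pt := by rw [f.map_pt, g.map_pt]
  map_act a x := by rw [f.map_act, g.map_act]

/-- The one point compactification of a space with an action of `C₂` by homeomorphisms; the base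
point is the (fixed) point at infinity. -/
def onePoint (X : Type*) [TopologicalSpace X] (a : C2 →* (X ≃ₜ X)) : PtdC2Space where
  carrier := OnePoint X
  pt := OnePoint.infty
  act g := OnePoint.map (a g)
  act_one x := by
    induction x using OnePoint.rec <;> simp
  act_mul g h x := by
    induction x using OnePoint.rec <;> simp
  continuous_act g := (a g).onePointCongr.continuous
  act_pt _ := rfl

/-- The points of `X × Y` on one of the two axes. -/
def OnAxes (X Y : PtdC2Space) (p : X × Y) : Prop := p.1 = X.pt ∨ p.2 = Y.pt

/-- The relation that collapses `X ∨ Y ⊆ X × Y`. -/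
def SmashRel (X Y : PtdC2Space) (p q : X × Y) : Prop := OnAxes X Y p ∧ OnAxes X Y q

lemma OnAxes.act {X Y : PtdC2Space} {p : X × Y} (h : OnAxes X Y p) (g : C2) :
    OnAxes X Y (X.act g p.1, Y.act g p.2) := by
  rcases h with h | h
  · exact Or.inl (by simp [h, X.act_pt])
  · exact Or.inr (by simp [h, Y.act_pt])

/-- The smash product `X ∧ Y = (X × Y) / (X ∨ Y)` with the diagonal action. -/
def smash (X Y : PtdC2Space) : PtdC2Space where
  carrier := Quot (SmashRel X Y)
  pt := Quot.mk _ (X.pt, Y.pt)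
  act g := Quot.map (fun p => (X.act g p.1, Y.act g p.2)) fun _ _ h => ⟨h.1.act g, h.2.act g⟩
  act_one x := by
    induction x using Quot.ind
    simp [Quot.map, X.act_one, Y.act_one]
  act_mul g h x := by
    induction x using Quot.ind
    simp [Quot.map, X.act_mul, Y.act_mul]
  continuous_act g := continuous_quot_lift _ <| continuous_quot_mk.comp <|
    ((X.continuous_act g).comp continuous_fst).prodMk ((Y.continuous_act g).comp continuous_snd)
  act_pt g := by simp [Quot.map, X.act_pt, Y.act_pt]

/-- The smash product of two maps. -/
def smashMap {X X' Y Y' : PtdC2Space} (f : PtdC2Hom X X') (g : PtdC2Hom Y Y') :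
    PtdC2Hom (smash X Y) (smash X' Y') where
  toFun := Quot.map (fun p => (f.toFun p.1, g.toFun p.2)) fun p q h => by
    have key : ∀ p : X × Y, OnAxes X Y p → OnAxes X' Y' (f.toFun p.1, g.toFun p.2) := by
      rintro p (h | h)
      · exact Or.inl ((congrArg f.toFun h).trans f.map_pt)
      · exact Or.inr ((congrArg g.toFun h).trans g.map_pt)
    exact ⟨key p h.1, key q h.2⟩
  continuous_toFun := continuous_quot_lift _ <| continuous_quot_mk.comp <|
    (f.continuous_toFun.comp continuous_fst).prodMk (g.continuous_toFun.comp continuous_snd)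
  map_pt := congrArg (Quot.mk _) (Prod.ext f.map_pt g.map_pt)
  map_act a x := by
    induction x using Quot.ind
    simp [smash, Quot.map, f.map_act, g.map_act]

/-- The identifications in `Y ⊔ (X × [0,1])` that define the reduced mapping cone of `f : X → Y`:
the end `X × {0}` and the segment over the base point are collapsed to the base point of `Y`, and
the end `X × {1}` is glued to `Y` along `f`. -/
inductive ConeRel {X Y : PtdC2Space} (f : PtdC2Hom X Y) : Y ⊕ (X × I) → Y ⊕ (X × I) → Prop
  | cone (x : X) : ConeRel f (Sum.inr (x, 0)) (Sum.inl Y.pt)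
  | base (t : I) : ConeRel f (Sum.inr (X.pt, t)) (Sum.inl Y.pt)
  | glue (x : X) : ConeRel f (Sum.inr (x, 1)) (Sum.inl (f.toFun x))

/-- The homotopy cofibre (reduced mapping cone) of `f : X → Y`; the group acts trivially on the
cone coordinate. -/
def homotopyCofibre {X Y : PtdC2Space} (f : PtdC2Hom X Y) : PtdC2Space where
  carrier := Quot (ConeRel f)
  pt := Quot.mk _ (Sum.inl Y.pt)
  act g := Quot.map (Sum.map (Y.act g) (fun p => (X.act g p.1, p.2))) fun p q h => by
    cases h with
    | cone x => simpa [Y.act_pt] using ConeRel.cone (f := f) (X.act g x)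
    | base t => simpa [Y.act_pt, X.act_pt] using ConeRel.base (f := f) t
    | glue x => simpa [f.map_act] using ConeRel.glue (f := f) (X.act g x)
  act_one x := by
    induction x using Quot.ind with | _ a =>
    rcases a with a | a <;> simp [Quot.map, X.act_one, Y.act_one]
  act_mul g h x := by
    induction x using Quot.ind with | _ a =>
    rcases a with a | a <;> simp [Quot.map, X.act_mul, Y.act_mul]
  continuous_act g := continuous_quot_lift _ <| continuous_quot_mk.comp <|
    (Y.continuous_act g).sumMap <|
      ((X.continuous_act g).comp continuous_fst).prodMk continuous_snd
  act_pt g := by simp [Quot.map, Y.act_pt]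

/-- A map `A × B → C` extended to one point compactifications, by `∞` if one argument is `∞`. -/
def extendTwo {A B C : Type*} (m : A × B → C) : OnePoint A × OnePoint B → OnePoint C
  | (OnePoint.some a, OnePoint.some b) => OnePoint.some (m (a, b))
  | (OnePoint.infty, _) => OnePoint.infty
  | (_, OnePoint.infty) => OnePoint.infty

lemma extendTwo_coe {A B C : Type*} (m : A × B → C) (a : A) (b : B) :
    extendTwo m ((a : OnePoint A), (b : OnePoint B)) = (m (a, b) : OnePoint C) := rfl

lemma extendTwo_infty_left {A B C : Type*} (m : A × B → C) (y : OnePoint B) :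
    extendTwo m (OnePoint.infty, y) = OnePoint.infty := by
  cases y using OnePoint.rec <;> rfl

lemma extendTwo_infty_right {A B C : Type*} (m : A × B → C) (x : OnePoint A) :
    extendTwo m (x, OnePoint.infty) = OnePoint.infty := by
  cases x using OnePoint.rec <;> rfl

/-- The extension of a proper continuous map to one point compactifications is continuous. -/
lemma continuous_extendTwo {A B C : Type*} [TopologicalSpace A] [TopologicalSpace B]
    [TopologicalSpace C] [T2Space A] [T2Space B] [WeaklyLocallyCompactSpace A]
    [WeaklyLocallyCompactSpace B] {m : A × B → C} (hc : Continuous m)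
    (hp : ∀ K : Set C, IsClosed K → IsCompact K → IsCompact (m ⁻¹' K)) :
    Continuous (extendTwo m) := by
  have hemb : Topology.IsOpenEmbedding
      (Prod.map ((↑) : A → OnePoint A) ((↑) : B → OnePoint B)) :=
    OnePoint.isOpenEmbedding_coe.prodMap OnePoint.isOpenEmbedding_coe
  have himg : ∀ S : Set (OnePoint C), OnePoint.infty ∉ S → extendTwo m ⁻¹' S =
      Prod.map ((↑) : A → OnePoint A) ((↑) : B → OnePoint B) '' (m ⁻¹' ((↑) ⁻¹' S)) := by
    intro S hS
    ext ⟨x, y⟩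
    constructor
    · intro h
      induction x using OnePoint.rec with
      | infty => exact absurd (extendTwo_infty_left m y ▸ h) hS
      | coe a =>
        induction y using OnePoint.rec with
        | infty => exact absurd (extendTwo_infty_right m (a : OnePoint A) ▸ h) hS
        | coe b => exact ⟨(a, b), h, rfl⟩
    · rintro ⟨⟨a, b⟩, h, he⟩
      rw [← he]
      exact h
  refine continuous_def.2 fun S hS => ?_
  by_cases h : OnePoint.infty ∈ S
  · have h' := (OnePoint.isOpen_iff_of_mem h).1 hS
    rw [← isClosed_compl_iff, ← Set.preimage_compl, himg _ (by simpa using h)]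
    refine ((hp _ ?_ ?_).image hemb.continuous).isClosed
    · exact h'.1
    · exact h'.2
  · rw [himg S h]
    exact hemb.isOpenMap _ (((OnePoint.isOpen_iff_of_notMem h).1 hS).preimage hc)

/-! ### Orthogonal representations of `C₂` -/

/-- An action of `C₂` on a real inner product space by linear isometries. -/
abbrev OrthRep (V : Type*) [NormedAddCommGroup V] [InnerProductSpace ℝ V] : Type _ :=
  C2 →* (V ≃ₗᵢ[ℝ] V)

/-- The trivial representation on `ℝ`. -/
noncomputable def trivialLine : OrthRep ℝ := 1

/-- The sign representation on `ℝ`: the generator acts as `x ↦ -x`. -/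
noncomputable def signLine : OrthRep ℝ where
  toFun g := if g = 1 then 1 else LinearIsometryEquiv.neg ℝ
  map_one' := by simp
  map_mul' g h := by
    have hg : g = 1 ∨ g = Multiplicative.ofAdd 1 := by revert g; decide
    have hh : h = 1 ∨ h = Multiplicative.ofAdd 1 := by revert h; decide
    have e : (Multiplicative.ofAdd 1 : C2) ≠ 1 := by decide
    have e2 : (Multiplicative.ofAdd 1 : C2) * Multiplicative.ofAdd 1 = 1 := by decide
    rcases hg with rfl | rfl <;> rcases hh with rfl | rfl <;> simp only [mul_one, one_mul, e, e2,
      if_true, if_false]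
    ext
    simp

section

variable {U V X W L : Type*}
  [NormedAddCommGroup U] [InnerProductSpace ℝ U]
  [NormedAddCommGroup V] [InnerProductSpace ℝ V]
  [NormedAddCommGroup X] [InnerProductSpace ℝ X]
  [NormedAddCommGroup W] [InnerProductSpace ℝ W]
  [NormedAddCommGroup L] [InnerProductSpace ℝ L]

/-- The orthogonal direct sum of two representations. -/
noncomputable def sumRep (ρ : OrthRep U) (τ : OrthRep L) : OrthRep (WithLp 2 (U × L)) where
  toFun g := LinearIsometryEquiv.withLpProdCongr 2 (ρ g) (τ g)
  map_one' := by rw [map_one, map_one]; rfl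
  map_mul' g h := by rw [map_mul, map_mul]; rfl

/-- The tensor product of two representations, with the diagonal action. -/
noncomputable def tensorRep (ρ : OrthRep W) (τ : OrthRep V) : OrthRep (W ⊗[ℝ] V) where
  toFun g := TensorProduct.congrIsometry (ρ g) (τ g)
  map_one' := by
    ext x
    induction x using TensorProduct.induction_on with
    | zero => simp
    | tmul w v => rw [map_one, map_one]; rfl
    | add x y hx hy => rw [map_add, hx, hy, map_add]
  map_mul' g h := by
    ext x
    induction x using TensorProduct.induction_on with
    | zero => simp
    | tmul w v => rw [map_mul, map_mul]; rfl
    | add x y hx hy => rw [map_add, hx, hy, map_add]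

/-! ### The complement bundle -/

/-- `W ⊗ K` as a subspace of `W ⊗ V`, for a subspace `K` of `V`. -/
noncomputable def tensorSub (W : Type*) [NormedAddCommGroup W] [InnerProductSpace ℝ W]
    (K : Submodule ℝ V) : Submodule ℝ (W ⊗[ℝ] V) :=
  LinearMap.range (LinearMap.lTensor W K.subtype)

lemma tmul_mem_tensorSub {K : Submodule ℝ V} (w : W) {k : V} (hk : k ∈ K) :
    w ⊗ₜ[ℝ] k ∈ tensorSub W K := ⟨w ⊗ₜ ⟨k, hk⟩, by simp⟩

lemma map_mem_tensorSub {K : Submodule ℝ V} {K' : Submodule ℝ X} {A : W →ₗ[ℝ] L} {B : V →ₗ[ℝ] X}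
    (h : ∀ k ∈ K, B k ∈ K') {x : W ⊗[ℝ] V} (hx : x ∈ tensorSub W K) :
    TensorProduct.map A B x ∈ tensorSub L K' := by
  obtain ⟨y, rfl⟩ := hx
  induction y using TensorProduct.induction_on with
  | zero => simp
  | tmul w k => simpa using tmul_mem_tensorSub (A w) (h k k.2)
  | add x y hx hy => rw [map_add, map_add]; exact add_mem hx hy

lemma tensorSub_mono {K K' : Submodule ℝ V} (h : K ≤ K') : tensorSub W K ≤ tensorSub W K' := by
  intro x hx
  have := map_mem_tensorSub (A := (LinearMap.id : W →ₗ[ℝ] W)) (B := (LinearMap.id : V →ₗ[ℝ] V))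
    (fun k hk => h hk) hx
  simpa using this

lemma inner_tensorSub_orthogonal {K : Submodule ℝ V} {x y : W ⊗[ℝ] V}
    (hx : x ∈ tensorSub W K) (hy : y ∈ tensorSub W Kᗮ) : ⟪x, y⟫_ℝ = 0 := by
  obtain ⟨a, rfl⟩ := hx
  obtain ⟨b, rfl⟩ := hy
  induction a using TensorProduct.induction_on with
  | zero => simp
  | add a a' h h' => rw [map_add, inner_add_left, h, h', add_zero]
  | tmul w k =>
    induction b using TensorProduct.induction_on with
    | zero => simp
    | add b b' h h' => rw [map_add, inner_add_right, h, h', add_zero]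
    | tmul w' k' => simp [Submodule.inner_right_of_mem_orthogonal k.2 k'.2]

lemma mem_tensorSub_orthogonal_iff [FiniteDimensional ℝ V] {K : Submodule ℝ V} {x : W ⊗[ℝ] V} :
    x ∈ tensorSub W Kᗮ ↔ ∀ (w : W), ∀ k ∈ K, ⟪w ⊗ₜ[ℝ] k, x⟫_ℝ = 0 := by
  refine ⟨fun hx w k hk => inner_tensorSub_orthogonal (tmul_mem_tensorSub w hk) hx, fun h => ?_⟩
  have h' : ∀ y ∈ tensorSub W K, ⟪y, x⟫_ℝ = 0 := by
    rintro _ ⟨y, rfl⟩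
    induction y using TensorProduct.induction_on with
    | zero => simp
    | tmul w k => simpa using h w k k.2
    | add y z hy hz => rw [map_add, inner_add_left, hy, hz, add_zero]
  have dec : ∀ z : W ⊗[ℝ] V, ∃ a ∈ tensorSub W K, ∃ b ∈ tensorSub W Kᗮ, z = a + b := by
    intro z
    induction z using TensorProduct.induction_on with
    | zero => exact ⟨0, zero_mem _, 0, zero_mem _, by simp⟩
    | tmul w v =>
      obtain ⟨a, ha, b, hb, rfl⟩ := K.exists_add_mem_mem_orthogonal v
      exact ⟨_, tmul_mem_tensorSub w ha, _, tmul_mem_tensorSub w hb, TensorProduct.tmul_add _ _ _⟩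
    | add y z hy hz =>
      obtain ⟨a, ha, b, hb, rfl⟩ := hy
      obtain ⟨a', ha', b', hb', rfl⟩ := hz
      exact ⟨_, add_mem ha ha', _, add_mem hb hb', by abel⟩
  obtain ⟨a, ha, b, hb, rfl⟩ := dec x
  have h0 := h' a ha
  rw [inner_add_right, inner_tensorSub_orthogonal ha hb, add_zero, inner_self_eq_zero] at h0
  simpa [h0] using hb

/-- The total space of the complement bundle as a set of pairs `(f, x)`: `f : U → V` is a linear
isometry (not necessarily equivariant or surjective) and `x ∈ W ⊗ f(U)ᗮ`. -/
def complementSet (W U V : Type*) [NormedAddCommGroup W] [InnerProductSpace ℝ W]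
    [NormedAddCommGroup U] [InnerProductSpace ℝ U] [NormedAddCommGroup V] [InnerProductSpace ℝ V] :
    Set ((U →L[ℝ] V) × (W ⊗[ℝ] V)) :=
  {p | (∀ u, ‖p.1 u‖ = ‖u‖) ∧ p.2 ∈ tensorSub W (LinearMap.range p.1.toLinearMap)ᗮ}

/-- The total space of the complement bundle, topologised as a subspace of
`Hom(U, V) × (W ⊗ V)`. -/
abbrev Complement (W U V : Type*) [NormedAddCommGroup W] [InnerProductSpace ℝ W]
    [NormedAddCommGroup U] [InnerProductSpace ℝ U] [NormedAddCommGroup V] [InnerProductSpace ℝ V] :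
    Type _ :=
  complementSet W U V

/-- The element `g` of `C₂` acts on pairs by `(f, x) ↦ (g f g⁻¹, g x)`. -/
noncomputable def complementAct (ρW : OrthRep W) (ρU : OrthRep U) (ρV : OrthRep V) (g : C2)
    (p : Complement W U V) : Complement W U V :=
  ⟨((ρV g : V →L[ℝ] V) ∘L p.1.1 ∘L (ρU g⁻¹ : U →L[ℝ] U), tensorRep ρW ρV g p.1.2), by
    obtain ⟨⟨f, x⟩, hf, hx⟩ := p
    refine ⟨fun u => ((ρV g).norm_map _).trans ((hf _).trans ((ρU g⁻¹).norm_map u)), ?_⟩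
    refine map_mem_tensorSub (A := (ρW g).toLinearEquiv.toLinearMap)
      (B := (ρV g).toLinearEquiv.toLinearMap) ?_ hx
    rintro k hk _ ⟨u, rfl⟩
    have := hk (f (ρU g⁻¹ u)) ⟨_, rfl⟩
    exact ((ρV g).inner_map_map _ _).trans this⟩

lemma continuous_complementAct (ρW : OrthRep W) (ρU : OrthRep U) (ρV : OrthRep V) (g : C2) :
    Continuous (complementAct ρW ρU ρV g) := by
  refine Continuous.subtype_mk (Continuous.prodMk ?_ ?_) _
  · exact continuous_const.clm_comp
      ((continuous_fst.comp continuous_subtype_val).clm_comp continuous_const)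
  · exact (tensorRep ρW ρV g).continuous.comp (continuous_snd.comp continuous_subtype_val)

lemma complementAct_one (ρW : OrthRep W) (ρU : OrthRep U) (ρV : OrthRep V) (p : Complement W U V) :
    complementAct ρW ρU ρV 1 p = p := by
  refine Subtype.ext (Prod.ext ?_ ?_)
  · ext u; simp [complementAct]
  · exact congrArg (fun r : W ⊗[ℝ] V ≃ₗᵢ[ℝ] W ⊗[ℝ] V => r p.1.2) (map_one (tensorRep ρW ρV))

lemma complementAct_mul (ρW : OrthRep W) (ρU : OrthRep U) (ρV : OrthRep V) (g h : C2)
    (p : Complement W U V) :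
    complementAct ρW ρU ρV (g * h) p = complementAct ρW ρU ρV g (complementAct ρW ρU ρV h p) := by
  refine Subtype.ext (Prod.ext ?_ ?_)
  · ext u; simp [complementAct]
  · exact congrArg (fun r : W ⊗[ℝ] V ≃ₗᵢ[ℝ] W ⊗[ℝ] V => r p.1.2) (map_mul (tensorRep ρW ρV) g h)

/-- The action of `C₂` on the total space of the complement bundle by homeomorphisms. -/
noncomputable def complementAction (ρW : OrthRep W) (ρU : OrthRep U) (ρV : OrthRep V) :
    C2 →* (Complement W U V ≃ₜ Complement W U V) where
  toFun g :=
    { toFun := complementAct ρW ρU ρV g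
      invFun := complementAct ρW ρU ρV g⁻¹
      left_inv := fun p => by rw [← complementAct_mul, inv_mul_cancel, complementAct_one]
      right_inv := fun p => by rw [← complementAct_mul, mul_inv_cancel, complementAct_one]
      continuous_toFun := continuous_complementAct ρW ρU ρV g
      continuous_invFun := continuous_complementAct ρW ρU ρV g⁻¹ }
  map_one' := by ext1 p; exact complementAct_one ρW ρU ρV p
  map_mul' g h := by ext1 p; exact complementAct_mul ρW ρU ρV g h p

/-- `J_W(U, V)`: the Thom space of the complement bundle. Its base space, the space of linear
isometries `U → V`, is compact, so the Thom space is the one point compactification of the total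
space. -/
noncomputable def Jet (ρW : OrthRep W) (ρU : OrthRep U) (ρV : OrthRep V) : PtdC2Space :=
  onePoint (Complement W U V) (complementAction ρW ρU ρV)

/-- The representation sphere `S^V`: the one point compactification of `V`. -/
noncomputable def repSphere (ρ : OrthRep V) : PtdC2Space :=
  onePoint V
    { toFun := fun g => (ρ g).toHomeomorph
      map_one' := by ext1 v; simp
      map_mul' := fun g h => by ext1 v; simp }

/-! ### Composition -/

/-- Composition of pairs: `(f, x) (g, y) ↦ (f ∘ g, x + (id ⊗ f) y)`. -/
noncomputable def complementComp (p : Complement W V X × Complement W U V) : Complement W U X :=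
  ⟨(p.1.1.1 ∘L p.2.1.1, p.1.1.2 + LinearMap.lTensor W p.1.1.1.toLinearMap p.2.1.2), by
    obtain ⟨⟨⟨f, x⟩, hf, hx⟩, ⟨⟨g, y⟩, hg, hy⟩⟩ := p
    have hf' : ∀ a b, ⟪f a, f b⟫_ℝ = ⟪a, b⟫_ℝ :=
      (LinearIsometry.mk f.toLinearMap hf).inner_map_map
    refine ⟨fun u => by simpa using (hf _).trans (hg u), add_mem ?_ ?_⟩
    · refine tensorSub_mono (Submodule.orthogonal_le ?_) hx
      rintro _ ⟨u, rfl⟩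
      exact ⟨g u, rfl⟩
    · refine map_mem_tensorSub (A := LinearMap.id) (B := f.toLinearMap) ?_ hy
      rintro k hk _ ⟨u, rfl⟩
      have := hk (g u) ⟨u, rfl⟩
      simpa [hf'] using this⟩

section

set_option linter.unusedSectionVars false

variable [FiniteDimensional ℝ U] [FiniteDimensional ℝ V] [FiniteDimensional ℝ X]
  [FiniteDimensional ℝ W] [FiniteDimensional ℝ L]

lemma isClosed_complementSet : IsClosed (complementSet W U V) := by
  have : complementSet W U V = (⋂ u : U, {p | ‖p.1 u‖ = ‖u‖}) ∩
      ⋂ (w : W) (u : U), {p | ⟪w ⊗ₜ[ℝ] (p.1 u), p.2⟫_ℝ = 0} := by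
    ext p
    simp [complementSet, mem_tensorSub_orthogonal_iff]
  rw [this]
  refine (isClosed_iInter fun u => isClosed_eq ?_ continuous_const).inter
    (isClosed_iInter fun w => isClosed_iInter fun u => isClosed_eq ?_ continuous_const)
  · fun_prop
  · have h1 : Continuous (TensorProduct.mk ℝ W V w) :=
      LinearMap.continuous_of_finiteDimensional _
    have h2 : Continuous fun p : (U →L[ℝ] V) × (W ⊗[ℝ] V) => p.1 u := by fun_prop
    exact (h1.comp h2).inner continuous_snd

instance : ProperSpace (Complement W U V) :=
  have : ProperSpace ((U →L[ℝ] V) × (W ⊗[ℝ] V)) := FiniteDimensional.proper_real _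
  .of_isClosed isClosed_complementSet

lemma continuous_complementComp :
    Continuous (complementComp : Complement W V X × Complement W U V → Complement W U X) := by
  let B : (V →L[ℝ] X) →L[ℝ] (W ⊗[ℝ] V) →L[ℝ] (W ⊗[ℝ] X) :=
    LinearMap.toContinuousBilinearMap
      ((LinearMap.lTensorHom W).comp (ContinuousLinearMap.coeLM ℝ))
  have hB : ∀ f y, B f y = LinearMap.lTensor W f.toLinearMap y := fun _ _ => rfl
  refine Continuous.subtype_mk (Continuous.prodMk ?_ ?_) _
  · fun_prop
  · simp only [← hB]
    fun_prop

lemma isCompact_preimage_complementComp (K : Set (Complement W U X)) (hK : IsClosed K)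
    (hK' : IsCompact K) :
    IsCompact ((complementComp : Complement W V X × Complement W U V → _) ⁻¹' K) := by
  obtain ⟨R, hR⟩ := (hK'.image (f := fun p : Complement W U X => ‖p.1.2‖)
    (continuous_snd.comp continuous_subtype_val).norm).bddAbove
  have hop : ∀ {A B : Type _} [NormedAddCommGroup A] [InnerProductSpace ℝ A]
      [NormedAddCommGroup B] [InnerProductSpace ℝ B] (f : A →L[ℝ] B), (∀ a, ‖f a‖ = ‖a‖) →
      ‖f‖ ≤ 1 := fun f hf => f.opNorm_le_bound zero_le_one fun a => by rw [hf, one_mul]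
  have hop' : ∀ {A B : Type _} [NormedAddCommGroup A] [InnerProductSpace ℝ A]
      [NormedAddCommGroup B] [InnerProductSpace ℝ B] (f : A →L[ℝ] B), (∀ a, ‖f a‖ = ‖a‖) →
      ‖f‖ ≤ 1 := fun f hf => f.opNorm_le_bound zero_le_one fun a => by rw [hf, one_mul]
  rcases Set.eq_empty_or_nonempty
    ((complementComp : Complement W V X × Complement W U V → _) ⁻¹' K) with he | ⟨p₀, hp₀⟩
  · rw [he]; exact isCompact_empty
  have hbd : ∀ p ∈ (complementComp : Complement W V X × Complement W U V → _) ⁻¹' K,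
      ‖p.1.1‖ ≤ max 1 R ∧ ‖p.2.1‖ ≤ max 1 R := by
    rintro ⟨⟨⟨f, x⟩, hf, hx⟩, ⟨⟨g, y⟩, hg, hy⟩⟩ hp
    have h1 : ‖x + LinearMap.lTensor W f.toLinearMap y‖ ≤ R := hR ⟨_, hp, rfl⟩
    have h2 : ‖LinearMap.lTensor W f.toLinearMap y‖ = ‖y‖ :=
      ((LinearIsometry.mk f.toLinearMap hf).lTensor W).norm_map y
    have h3 : ⟪LinearMap.lTensor W f.toLinearMap y, x⟫_ℝ = 0 :=
      inner_tensorSub_orthogonal (K := LinearMap.range f.toLinearMap) (by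
        refine map_mem_tensorSub (A := LinearMap.id) (B := f.toLinearMap) ?_ hy
        exact fun k _ => ⟨k, rfl⟩) hx
    have h4 := norm_add_sq_real x (LinearMap.lTensor W f.toLinearMap y)
    rw [real_inner_comm, h3, h2] at h4
    have h5 := norm_nonneg (x + LinearMap.lTensor W f.toLinearMap y)
    have hx' : ‖x‖ ≤ R := by
      refine le_trans (abs_le_of_sq_le_sq' ?_ h5).2 h1
      nlinarith [sq_nonneg ‖y‖]
    have hy' : ‖y‖ ≤ R := by
      refine le_trans (abs_le_of_sq_le_sq' ?_ h5).2 h1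
      nlinarith [sq_nonneg ‖x‖]
    exact ⟨max_le_max (hop f hf) hx', max_le_max (hop' g hg) hy'⟩
  refine (isCompact_closedBall p₀ (2 * max 1 R)).of_isClosed_subset
    (hK.preimage continuous_complementComp) fun p hp => ?_
  obtain ⟨a, b⟩ := hbd p hp
  obtain ⟨c, d⟩ := hbd p₀ hp₀
  refine Metric.mem_closedBall.2 (max_le ?_ ?_)
  · refine (dist_le_norm_add_norm p.1.1 p₀.1.1).trans ?_
    linarith
  · refine (dist_le_norm_add_norm p.2.1 p₀.2.1).trans ?_
    linarith

lemma complementComp_act (ρW : OrthRep W) (ρU : OrthRep U) (ρV : OrthRep V) (ρX : OrthRep X)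
    (g : C2) (p : Complement W V X) (q : Complement W U V) :
    complementComp (complementAct ρW ρV ρX g p, complementAct ρW ρU ρV g q) =
      complementAct ρW ρU ρX g (complementComp (p, q)) := by
  obtain ⟨⟨f, x⟩, hf, hx⟩ := p
  obtain ⟨⟨h, y⟩, hh, hy⟩ := q
  have key : ∀ v, ρV g⁻¹ (ρV g v) = v := fun v => by
    simp
  refine Subtype.ext (Prod.ext ?_ ?_)
  · ext u
    change ρX g (f (ρV g⁻¹ (ρV g (h (ρU g⁻¹ u))))) = ρX g (f (h (ρU g⁻¹ u)))
    rw [key]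
  · change tensorRep ρW ρX g x + LinearMap.lTensor W
        ((ρX g : X →L[ℝ] X) ∘L f ∘L (ρV g⁻¹ : V →L[ℝ] V)).toLinearMap (tensorRep ρW ρV g y) =
      tensorRep ρW ρX g (x + LinearMap.lTensor W f.toLinearMap y)
    rw [map_add]
    congr 1
    clear hy hh
    induction y using TensorProduct.induction_on with
    | zero => simp
    | tmul w v =>
      change ρW g w ⊗ₜ[ℝ] ρX g (f (ρV g⁻¹ (ρV g v))) = ρW g w ⊗ₜ[ℝ] ρX g (f v)
      rw [key]
    | add y z hy hz => simp only [map_add, hy, hz]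

/-- The composition map `J_W(V, X) ∧ J_W(U, V) → J_W(U, X)` obtained from composition of pairs by
passing to Thom spaces. -/
noncomputable def jetComp (ρW : OrthRep W) (ρU : OrthRep U) (ρV : OrthRep V) (ρX : OrthRep X) :
    PtdC2Hom (smash (Jet ρW ρV ρX) (Jet ρW ρU ρV)) (Jet ρW ρU ρX) where
  toFun := Quot.lift (extendTwo (complementComp : Complement W V X × Complement W U V → _)) <| by
    have key : ∀ p, OnAxes (Jet ρW ρV ρX) (Jet ρW ρU ρV) p → extendTwo
        (complementComp : Complement W V X × Complement W U V → Complement W U X) p =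
          OnePoint.infty := by
      rintro ⟨x, y⟩ (h | h)
      · exact (congrArg (fun z => extendTwo complementComp (z, y)) h).trans
          (extendTwo_infty_left _ y)
      · exact (congrArg (fun z => extendTwo complementComp (x, z)) h).trans
          (extendTwo_infty_right _ x)
    exact fun p q h => (key p h.1).trans (key q h.2).symm
  continuous_toFun := continuous_quot_lift _ <|
    continuous_extendTwo continuous_complementComp isCompact_preimage_complementComp
  map_pt := rfl
  map_act g z := by
    induction z using Quot.ind with | _ p =>
    obtain ⟨x, y⟩ := p
    change extendTwo complementComp (OnePoint.map (complementAct ρW ρV ρX g) x,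
      OnePoint.map (complementAct ρW ρU ρV g) y) =
        OnePoint.map (complementAct ρW ρU ρX g) (extendTwo complementComp (x, y))
    induction x using OnePoint.rec with
    | infty =>
      rw [OnePoint.map_infty]
      exact (extendTwo_infty_left _ _).trans
        (congrArg (OnePoint.map (complementAct ρW ρU ρX g)) (extendTwo_infty_left _ _)).symm
    | coe a =>
      induction y using OnePoint.rec with
      | infty => simp [extendTwo_infty_right]
      | coe b =>
        simp only [OnePoint.map_some, extendTwo_coe]
        rw [complementComp_act]

end

/-! ### The restricted composition map -/

/-- The standard inclusion `U → U ⊕ L`. -/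
noncomputable def sumInl (U L : Type*) [NormedAddCommGroup U] [InnerProductSpace ℝ U]
    [NormedAddCommGroup L] [InnerProductSpace ℝ L] : U →L[ℝ] WithLp 2 (U × L) :=
  ((WithLp.prodContinuousLinearEquiv 2 ℝ U L).symm : U × L →L[ℝ] WithLp 2 (U × L)) ∘L
    ContinuousLinearMap.inl ℝ U L

/-- The inclusion `L → U ⊕ L` of the second summand. -/
noncomputable def sumInr (U L : Type*) [NormedAddCommGroup U] [InnerProductSpace ℝ U]
    [NormedAddCommGroup L] [InnerProductSpace ℝ L] : L →ₗᵢ[ℝ] WithLp 2 (U × L) where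
  toFun l := WithLp.toLp 2 (0, l)
  map_add' a b := by rw [← WithLp.toLp_add, Prod.mk_add_mk, add_zero]
  map_smul' c a := by rw [RingHom.id_apply, ← WithLp.toLp_smul, Prod.smul_mk, smul_zero]
  norm_map' l := WithLp.norm_toLp_snd 2 U L l

/-- The embedding `x ↦ (i, x)` of `W ⊗ L` into the total space of the complement bundle for
`U, U ⊕ L`, where `i : U → U ⊕ L` is the standard inclusion, whose complement is `L`. -/
noncomputable def fibreIncl (W U L : Type*) [NormedAddCommGroup W] [InnerProductSpace ℝ W]
    [NormedAddCommGroup U] [InnerProductSpace ℝ U] [NormedAddCommGroup L] [InnerProductSpace ℝ L]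
    (x : W ⊗[ℝ] L) : Complement W U (WithLp 2 (U × L)) :=
  ⟨(sumInl U L, LinearMap.lTensor W (sumInr U L).toLinearMap x),
    fun u => WithLp.norm_toLp_fst 2 U L u, by
    have hx : x ∈ tensorSub W (⊤ : Submodule ℝ L) := by
      induction x using TensorProduct.induction_on with
      | zero => exact zero_mem _
      | tmul w l => exact tmul_mem_tensorSub w trivial
      | add x y hx hy => exact add_mem hx hy
    refine map_mem_tensorSub (A := LinearMap.id) (B := (sumInr U L).toLinearMap) ?_ hx
    rintro l - _ ⟨u, rfl⟩
    simp [sumInl, sumInr, WithLp.prodContinuousLinearEquiv_symm_apply]⟩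

lemma isometry_fibreIncl : Isometry (fibreIncl W U L) := by
  refine Isometry.of_dist_eq fun x y => ?_
  change max (dist (sumInl U L) (sumInl U L)) (dist ((sumInr U L).lTensor W x)
    ((sumInr U L).lTensor W y)) = _
  rw [LinearIsometry.dist_map, dist_self, max_eq_right dist_nonneg]

lemma fibreIncl_act (ρW : OrthRep W) (ρU : OrthRep U) (τ : OrthRep L) (g : C2) (x : W ⊗[ℝ] L) :
    fibreIncl W U L (tensorRep ρW τ g x) =
      complementAct ρW ρU (sumRep ρU τ) g (fibreIncl W U L x) := by
  refine Subtype.ext (Prod.ext ?_ ?_)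
  · ext u : 1
    change WithLp.toLp 2 (u, (0 : L)) = WithLp.toLp 2 (ρU g (ρU g⁻¹ u), τ g 0)
    have key : ρU g (ρU g⁻¹ u) = u := by simp
    rw [key, map_zero]
  · change LinearMap.lTensor W (sumInr U L).toLinearMap (tensorRep ρW τ g x) =
      tensorRep ρW (sumRep ρU τ) g (LinearMap.lTensor W (sumInr U L).toLinearMap x)
    induction x using TensorProduct.induction_on with
    | zero => simp
    | tmul w l =>
      change ρW g w ⊗ₜ[ℝ] WithLp.toLp 2 ((0 : U), τ g l) =
        ρW g w ⊗ₜ[ℝ] WithLp.toLp 2 (ρU g 0, τ g l)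
      rw [map_zero]
    | add y z hy hz => simp only [map_add, hy, hz]

/-- The map `S^{W ⊗ L} → J_W(U, U ⊕ L)`, `x ↦ (i, x)`, `∞ ↦ ∞`, that identifies the
representation sphere with a subspace of `J_W(U, U ⊕ L)`. -/
noncomputable def sphereIncl [FiniteDimensional ℝ W] [FiniteDimensional ℝ L]
    (ρW : OrthRep W) (ρU : OrthRep U) (τ : OrthRep L) :
    PtdC2Hom (repSphere (tensorRep ρW τ)) (Jet ρW ρU (sumRep ρU τ)) where
  toFun := OnePoint.map (fibreIncl W U L)
  continuous_toFun := by
    refine OnePoint.continuous_map isometry_fibreIncl.continuous ?_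
    rw [Filter.coclosedCompact_eq_cocompact, Filter.coclosedCompact_eq_cocompact]
    have : CompleteSpace (W ⊗[ℝ] L) := FiniteDimensional.complete ℝ _
    exact isometry_fibreIncl.isClosedEmbedding.tendsto_cocompact
  map_pt := rfl
  map_act g x := by
    change OnePoint.map (fibreIncl W U L) (OnePoint.map (tensorRep ρW τ g) x) =
      OnePoint.map (complementAct ρW ρU (sumRep ρU τ) g) (OnePoint.map (fibreIncl W U L) x)
    induction x using OnePoint.rec with
    | infty => rfl
    | coe x => exact congrArg OnePoint.some (fibreIncl_act ρW ρU τ g x)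

/-- The subspace of the pairs `(i, x)` in `J_W(U, U ⊕ L)`, where `i : U → U ⊕ L` is the standard
inclusion. -/
def pairsOverIncl (ρW : OrthRep W) (ρU : OrthRep U) (τ : OrthRep L) :
    Set (Jet ρW ρU (sumRep ρU τ)) :=
  {p | ∃ q : Complement W U (WithLp 2 (U × L)), q.1.1 = sumInl U L ∧ p = OnePoint.some q}

/-- The restricted composition map `J_W(U ⊕ L, V) ∧ S^{W ⊗ L} → J_W(U, V)`: composition
`J_W(U ⊕ L, V) ∧ J_W(U, U ⊕ L) → J_W(U, V)` restricted along the embedding of the sphere. -/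
noncomputable def restrictedComp [FiniteDimensional ℝ W] [FiniteDimensional ℝ L]
    [FiniteDimensional ℝ U] [FiniteDimensional ℝ V]
    (ρW : OrthRep W) (ρU : OrthRep U) (τ : OrthRep L) (ρV : OrthRep V) :
    PtdC2Hom (smash (Jet ρW (sumRep ρU τ) ρV) (repSphere (tensorRep ρW τ))) (Jet ρW ρU ρV) :=
  (jetComp ρW ρU (sumRep ρU τ) ρV).comp (smashMap (PtdC2Hom.id _) (sphereIncl ρW ρU τ))

end

end C2Calculus

open C2Calculus

/-!
A point of the complement bundle for `W ⊕ ℝ^α` is a triple `(f, x, v)` with `f : U → V` an isometry,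
`x ∈ W ⊗ f(U)ᗮ` and `v ∈ f(U)ᗮ`. The triples with `v = 0` form the complement bundle for `W`. If
`v ≠ 0`, then `f` extends to the isometry `F : U ⊕ ℝ → V` with `F(0, 1) = v / ‖v‖`, and the orthogonal
decomposition `W ⊗ f(U)ᗮ = (W ⊗ F(U ⊕ ℝ)ᗮ) ⊕ F(W ⊗ ℝ)` writes `x` uniquely as `y + F(w)`. Thus
`(f, x, v)` is the same as `(F, y)`, `w` and the radius `r = ‖v‖ > 0` (`exists_polar_eq`,
`polar_injective`), and with `r = (1 - t) / t` these data are the points of the open cone on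
`J_W(U ⊕ ℝ^α, V) ∧ S^{W ⊗ ℝ^α}`. As `t → 1` the triple tends to `(f, y + F(w), 0)`, which is the
composite of `(F, y)` and `(i, w)` (`coneLevel_one`); as `t → 0` it tends to infinity.

The comparison map `cofibreMap` is continuous and equivariant because composition is: at each level
`t` it is the restricted composition map for `W ⊕ ℝ^α`, applied to `(F, (y, 0))` and
`(i, (w, r))`. The map `(w, t) ↦ (w, r)` extends to the one point compactifications since
`(W ⊗ ℝ) × ℝ ≅ (W ⊕ ℝ) ⊗ ℝ` is proper, and it is equivariant since `ℝ^α ⊗ ℝ^α` is trivial. A continuous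
bijection from a compact space to a Hausdorff space is a homeomorphism.

For the sphere, `sphereIncl` is injective from a compact space to a Hausdorff space, hence a closed
embedding, and its image is `∞` together with all pairs over the inclusion, because the orthogonal
complement of `U` in `U ⊕ ℝ` is `ℝ`. If `W ≠ 0`, then `W ⊗ ℝ` is not compact, so it is dense in its
one point compactification.
-/

namespace C2Calculus

/-! ### Coordinates on `(W ⊕ ℝ) ⊗ V` -/

section Coordinates

variable {W V X : Type*} [NormedAddCommGroup W] [InnerProductSpace ℝ W]
  [NormedAddCommGroup V] [InnerProductSpace ℝ V] [NormedAddCommGroup X] [InnerProductSpace ℝ X]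

variable (W) in
/-- The isometric inclusion `W → W ⊕ ℝ` of the first summand. -/
noncomputable def sumInlIsometry : W →ₗᵢ[ℝ] WithLp 2 (W × ℝ) where
  toLinearMap := (sumInl W ℝ).toLinearMap
  norm_map' w := WithLp.norm_toLp_fst 2 W ℝ w

variable (W V) in
/-- The coordinate in `W ⊗ V` of an element of `(W ⊕ ℝ) ⊗ V ≅ (W ⊗ V) ⊕ V`. -/
noncomputable def tensorFst : WithLp 2 (W × ℝ) ⊗[ℝ] V →ₗ[ℝ] W ⊗[ℝ] V :=
  (WithLp.fstₗ 2 ℝ W ℝ).rTensor V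

variable (W V) in
/-- The coordinate in `V` of an element of `(W ⊕ ℝ) ⊗ V ≅ (W ⊗ V) ⊕ V`. -/
noncomputable def tensorSnd : WithLp 2 (W × ℝ) ⊗[ℝ] V →ₗ[ℝ] V :=
  TensorProduct.lid ℝ V ∘ₗ (WithLp.sndₗ 2 ℝ W ℝ).rTensor V

variable (W V) in
/-- The isometric inclusion `W ⊗ V → (W ⊕ ℝ) ⊗ V`. -/
noncomputable def tensorInl : W ⊗[ℝ] V →ₗᵢ[ℝ] WithLp 2 (W × ℝ) ⊗[ℝ] V :=
  (sumInlIsometry W).rTensor V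

variable (W V) in
/-- The inclusion `V ≅ ℝ ⊗ V → (W ⊕ ℝ) ⊗ V`. -/
noncomputable def tensorInr : V →ₗ[ℝ] WithLp 2 (W × ℝ) ⊗[ℝ] V :=
  TensorProduct.mk ℝ _ V (WithLp.toLp 2 ((0 : W), (1 : ℝ)))

@[simp] lemma tensorFst_tmul (a : WithLp 2 (W × ℝ)) (v : V) :
    tensorFst W V (a ⊗ₜ v) = a.fst ⊗ₜ v := rfl

@[simp] lemma tensorSnd_tmul (a : WithLp 2 (W × ℝ)) (v : V) :
    tensorSnd W V (a ⊗ₜ v) = a.snd • v := rfl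

@[simp] lemma tensorInl_tmul (w : W) (v : V) :
    tensorInl W V (w ⊗ₜ v) = WithLp.toLp 2 (w, (0 : ℝ)) ⊗ₜ v := rfl

lemma tensorInr_apply (v : V) :
    tensorInr W V v = WithLp.toLp 2 ((0 : W), (1 : ℝ)) ⊗ₜ v := rfl

@[simp] lemma tensorFst_tensorInl (x : W ⊗[ℝ] V) : tensorFst W V (tensorInl W V x) = x := by
  induction x using TensorProduct.induction_on with
  | zero => simp
  | tmul w v => simp
  | add x y hx hy => rw [map_add, map_add, hx, hy]

@[simp] lemma tensorSnd_tensorInl (x : W ⊗[ℝ] V) : tensorSnd W V (tensorInl W V x) = 0 := by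
  induction x using TensorProduct.induction_on with
  | zero => simp
  | tmul w v => simp
  | add x y hx hy => rw [map_add, map_add, hx, hy, add_zero]

@[simp] lemma tensorFst_tensorInr (v : V) : tensorFst W V (tensorInr W V v) = 0 := by
  simp [tensorInr_apply]

@[simp] lemma tensorSnd_tensorInr (v : V) : tensorSnd W V (tensorInr W V v) = v := by
  simp [tensorInr_apply]

lemma tensorInl_add_tensorInr (z : WithLp 2 (W × ℝ) ⊗[ℝ] V) :
    tensorInl W V (tensorFst W V z) + tensorInr W V (tensorSnd W V z) = z := by
  induction z using TensorProduct.induction_on with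
  | zero => simp
  | tmul a v =>
    rw [tensorFst_tmul, tensorSnd_tmul, tensorInl_tmul, tensorInr_apply, TensorProduct.tmul_smul,
      TensorProduct.smul_tmul', ← TensorProduct.add_tmul]
    congr 1
    change WithLp.toLp 2 (a.fst + a.snd • 0, 0 + a.snd * 1) = a
    rw [smul_zero, add_zero, zero_add, mul_one]
    rfl
  | add x y hx hy => simp only [map_add]; rw [add_add_add_comm, hx, hy]

lemma tensor_ext {z z' : WithLp 2 (W × ℝ) ⊗[ℝ] V} (h : tensorFst W V z = tensorFst W V z')
    (h' : tensorSnd W V z = tensorSnd W V z') : z = z' := by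
  rw [← tensorInl_add_tensorInr z, h, h', tensorInl_add_tensorInr]

lemma tensorFst_lTensor (f : V →ₗ[ℝ] X) (z : WithLp 2 (W × ℝ) ⊗[ℝ] V) :
    tensorFst W X (f.lTensor _ z) = f.lTensor W (tensorFst W V z) := by
  induction z using TensorProduct.induction_on with
  | zero => simp
  | tmul w v => simp
  | add x y hx hy => simp only [map_add, hx, hy]

lemma tensorSnd_lTensor (f : V →ₗ[ℝ] X) (z : WithLp 2 (W × ℝ) ⊗[ℝ] V) :
    tensorSnd W X (f.lTensor _ z) = f (tensorSnd W V z) := by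
  induction z using TensorProduct.induction_on with
  | zero => simp
  | tmul w v => simp
  | add x y hx hy => simp only [map_add, hx, hy]

lemma tensorFst_mem {K : Submodule ℝ V} {z : WithLp 2 (W × ℝ) ⊗[ℝ] V}
    (hz : z ∈ tensorSub (WithLp 2 (W × ℝ)) K) : tensorFst W V z ∈ tensorSub W K :=
  map_mem_tensorSub (A := WithLp.fstₗ 2 ℝ W ℝ) (B := LinearMap.id) (fun _ hk => hk) hz

lemma tensorSnd_mem {K : Submodule ℝ V} {z : WithLp 2 (W × ℝ) ⊗[ℝ] V}
    (hz : z ∈ tensorSub (WithLp 2 (W × ℝ)) K) : tensorSnd W V z ∈ K := by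
  obtain ⟨y, rfl⟩ := hz
  rw [tensorSnd_lTensor]
  exact Subtype.property _

lemma tensorInl_mem {K : Submodule ℝ V} {x : W ⊗[ℝ] V} (hx : x ∈ tensorSub W K) :
    tensorInl W V x ∈ tensorSub (WithLp 2 (W × ℝ)) K :=
  map_mem_tensorSub (A := (sumInl W ℝ).toLinearMap) (B := LinearMap.id) (fun _ hk => hk) hx

lemma tensorInl_act (ρW : OrthRep W) (ρV : OrthRep V) (α : OrthRep ℝ) (g : C2) (x : W ⊗[ℝ] V) :
    tensorInl W V (tensorRep ρW ρV g x) = tensorRep (sumRep ρW α) ρV g (tensorInl W V x) := by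
  induction x using TensorProduct.induction_on with
  | zero => simp
  | tmul w v =>
    change WithLp.toLp 2 (ρW g w, (0 : ℝ)) ⊗ₜ[ℝ] ρV g v =
      WithLp.toLp 2 (ρW g w, α g 0) ⊗ₜ[ℝ] ρV g v
    rw [map_zero]
  | add y z hy hz => simp only [map_add, hy, hz]

end Coordinates

/-! ### The inclusion `J_W(U, V) → J_{W ⊕ ℝ}(U, V)` -/

section WeightInclusion

variable {U V W : Type*}
  [NormedAddCommGroup U] [InnerProductSpace ℝ U]
  [NormedAddCommGroup V] [InnerProductSpace ℝ V]
  [NormedAddCommGroup W] [InnerProductSpace ℝ W]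

/-- The inclusion `(f, x) ↦ (f, (x, 0))` of complement bundles. -/
noncomputable def complementIncl (p : Complement W U V) :
    Complement (WithLp 2 (W × ℝ)) U V :=
  ⟨(p.1.1, tensorInl W V p.1.2), p.2.1, tensorInl_mem p.2.2⟩

lemma isometry_complementIncl :
    Isometry (complementIncl : Complement W U V → Complement (WithLp 2 (W × ℝ)) U V) := by
  refine Isometry.of_dist_eq fun p q => ?_
  change max (dist p.1.1 q.1.1) (dist (tensorInl W V p.1.2) (tensorInl W V q.1.2)) =
    max (dist p.1.1 q.1.1) (dist p.1.2 q.1.2)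
  rw [LinearIsometry.dist_map]

lemma complementIncl_act (ρW : OrthRep W) (ρU : OrthRep U) (ρV : OrthRep V) (α : OrthRep ℝ)
    (g : C2) (p : Complement W U V) :
    complementIncl (complementAct ρW ρU ρV g p) =
      complementAct (sumRep ρW α) ρU ρV g (complementIncl p) := by
  obtain ⟨⟨f, x⟩, hf, hx⟩ := p
  refine Subtype.ext (Prod.ext rfl ?_)
  exact tensorInl_act ρW ρV α g x

/-- `J_W(U, V)` sits in `J_{W ⊕ ℝ}(U, V)` as the part with vanishing coordinate in `f(U)ᗮ`. -/
lemma exists_complementIncl_eq {q : Complement (WithLp 2 (W × ℝ)) U V}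
    (hq : tensorSnd W V q.1.2 = 0) : ∃ p : Complement W U V, complementIncl p = q := by
  obtain ⟨⟨f, z⟩, hf, hz⟩ := q
  refine ⟨⟨(f, tensorFst W V z), hf, tensorFst_mem hz⟩, Subtype.ext (Prod.ext rfl ?_)⟩
  exact tensor_ext (tensorFst_tensorInl _) ((tensorSnd_tensorInl _).trans hq.symm)

variable [FiniteDimensional ℝ U] [FiniteDimensional ℝ V] [FiniteDimensional ℝ W]

/-- The inclusion `J_W(U, V) → J_{W ⊕ ℝ^α}(U, V)` of Thom spaces. -/
noncomputable def jetIncl (ρW : OrthRep W) (ρU : OrthRep U) (ρV : OrthRep V) (α : OrthRep ℝ) :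
    PtdC2Hom (Jet ρW ρU ρV) (Jet (sumRep ρW α) ρU ρV) where
  toFun := OnePoint.map complementIncl
  continuous_toFun := by
    refine OnePoint.continuous_map isometry_complementIncl.continuous ?_
    rw [Filter.coclosedCompact_eq_cocompact, Filter.coclosedCompact_eq_cocompact]
    exact isometry_complementIncl.isClosedEmbedding.tendsto_cocompact
  map_pt := rfl
  map_act g x := by
    change OnePoint.map complementIncl (OnePoint.map (complementAct ρW ρU ρV g) x) =
      OnePoint.map (complementAct (sumRep ρW α) ρU ρV g) (OnePoint.map complementIncl x)
    induction x using OnePoint.rec with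
    | infty => rfl
    | coe x => exact congrArg OnePoint.some (complementIncl_act ρW ρU ρV α g x)

end WeightInclusion

/-! ### The cone coordinate -/

section Cone

/-- The homeomorphism `t ↦ (1 - t) / t` from `[0, 1]` onto `[0, ∞]`, as a map to the one point
compactification of `ℝ`. -/
noncomputable def coneRadius (t : I) : OnePoint ℝ :=
  if t = 0 then OnePoint.infty else OnePoint.some ((1 - (t : ℝ)) / t)

lemma coneRadius_zero : coneRadius 0 = OnePoint.infty := if_pos rfl

lemma coneRadius_of_ne {t : I} (ht : t ≠ 0) :
    coneRadius t = OnePoint.some ((1 - (t : ℝ)) / t) := if_neg ht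

lemma continuous_coneRadius : Continuous coneRadius := by
  rw [continuous_iff_continuousAt]
  intro t
  by_cases ht : t = 0
  · subst ht
    rw [← continuousWithinAt_compl_self, ContinuousWithinAt, coneRadius_zero]
    have h1 : Filter.Tendsto (fun t : I => (1 - (t : ℝ)) / t) (nhdsWithin 0 {0}ᶜ) Filter.atTop := by
      have h2 : Filter.Tendsto (fun t : I => ((t : ℝ))⁻¹) (nhdsWithin 0 {0}ᶜ) Filter.atTop := by
        refine Filter.Tendsto.comp tendsto_inv_nhdsGT_zero ?_
        refine tendsto_nhdsWithin_iff.2 ⟨?_, ?_⟩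
        · exact (continuous_subtype_val.tendsto (0 : I)).mono_left nhdsWithin_le_nhds
        · filter_upwards [self_mem_nhdsWithin] with t ht
          exact unitInterval.pos_iff_ne_zero.2 ht
      refine (Filter.tendsto_atTop_add_const_right _ (-1) h2).congr' ?_
      filter_upwards [self_mem_nhdsWithin] with t ht
      have : (t : ℝ) ≠ 0 := fun h => ht (Subtype.ext h)
      field_simp
      ring
    have h3 : Filter.Tendsto ((↑) : ℝ → OnePoint ℝ) Filter.atTop (nhds OnePoint.infty) :=
      OnePoint.tendsto_coe_infty.mono_left
        (Filter.coclosedCompact_eq_cocompact (X := ℝ) ▸ atTop_le_cocompact)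
    refine (h3.comp h1).congr' ?_
    filter_upwards [self_mem_nhdsWithin] with t ht
    exact (coneRadius_of_ne ht).symm
  · have h0 : (t : ℝ) ≠ 0 := fun h => ht (Subtype.ext h)
    have h1 : ContinuousAt (fun t : I => (((1 - (t : ℝ)) / t : ℝ) : OnePoint ℝ)) t :=
      OnePoint.continuous_coe.continuousAt.comp
        ((continuousAt_const.sub continuousAt_subtype_val).div continuousAt_subtype_val h0)
    refine h1.congr ?_
    filter_upwards [isOpen_ne.mem_nhds ht] with s hs
    exact (coneRadius_of_ne hs).symm

variable {W : Type*} [NormedAddCommGroup W] [InnerProductSpace ℝ W]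

variable (W) in
/-- The isomorphism `(W ⊗ ℝ) ⊕ ℝ ≅ (W ⊕ ℝ) ⊗ ℝ`. -/
noncomputable def addLine : ((W ⊗[ℝ] ℝ) × ℝ) ≃ₗ[ℝ] WithLp 2 (W × ℝ) ⊗[ℝ] ℝ where
  toLinearMap := (tensorInl W ℝ).toLinearMap.coprod (tensorInr W ℝ)
  invFun z := (tensorFst W ℝ z, tensorSnd W ℝ z)
  left_inv p := by
    change (tensorFst W ℝ (tensorInl W ℝ p.1 + tensorInr W ℝ p.2),
      tensorSnd W ℝ (tensorInl W ℝ p.1 + tensorInr W ℝ p.2)) = p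
    simp
  right_inv z := tensorInl_add_tensorInr z

lemma addLine_apply (p : (W ⊗[ℝ] ℝ) × ℝ) :
    addLine W p = tensorInl W ℝ p.1 + tensorInr W ℝ p.2 := rfl

@[simp] lemma tensorFst_addLine (p : (W ⊗[ℝ] ℝ) × ℝ) : tensorFst W ℝ (addLine W p) = p.1 := by
  simp [addLine_apply]

@[simp] lemma tensorSnd_addLine (p : (W ⊗[ℝ] ℝ) × ℝ) : tensorSnd W ℝ (addLine W p) = p.2 := by
  simp [addLine_apply]

/-- `ℝ^α ⊗ ℝ^α` is the trivial representation. -/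
lemma tensorInr_line_act (ρW : OrthRep W) (α : OrthRep ℝ) (g : C2) (r : ℝ) :
    tensorRep (sumRep ρW α) α g (tensorInr W ℝ r) = tensorInr W ℝ r := by
  change WithLp.toLp 2 (ρW g 0, α g 1) ⊗ₜ[ℝ] α g r = WithLp.toLp 2 ((0 : W), (1 : ℝ)) ⊗ₜ[ℝ] r
  have h1 : α g r = r * α g 1 := by
    simpa using (α g).map_smul r 1
  have h2 : α g 1 * α g 1 = 1 := by
    have h : |α g 1| = 1 := ((α g).norm_map 1).trans norm_one
    rw [← abs_mul_abs_self, h, one_mul]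
  have h3 : WithLp.toLp 2 ((0 : W), α g 1) = α g 1 • WithLp.toLp 2 ((0 : W), (1 : ℝ)) := by
    rw [← WithLp.toLp_smul]; simp
  rw [map_zero, h3, TensorProduct.smul_tmul, h1, smul_eq_mul, mul_left_comm, h2, mul_one]

lemma addLine_act (ρW : OrthRep W) (α : OrthRep ℝ) (g : C2) (w : W ⊗[ℝ] ℝ) (r : ℝ) :
    addLine W (tensorRep ρW α g w, r) = tensorRep (sumRep ρW α) α g (addLine W (w, r)) := by
  rw [addLine_apply, addLine_apply, map_add, tensorInr_line_act, tensorInl_act]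

variable [FiniteDimensional ℝ W]

lemma continuous_extendTwo_addLine : Continuous (extendTwo (addLine W)) := by
  have : ProperSpace (W ⊗[ℝ] ℝ) := FiniteDimensional.proper_real _
  refine continuous_extendTwo (addLine W).toContinuousLinearEquiv.continuous fun K _ hK => ?_
  exact (addLine W).toContinuousLinearEquiv.toHomeomorph.isCompact_preimage.2 hK

/-- The map `S^{W ⊗ ℝ^α} → S^{(W ⊕ ℝ^α) ⊗ ℝ^α}` at level `t` of the cone, `w ↦ (w, (1 - t) / t)`. -/
noncomputable def coneSphere (ρW : OrthRep W) (α : OrthRep ℝ) (t : I) :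
    PtdC2Hom (repSphere (tensorRep ρW α)) (repSphere (tensorRep (sumRep ρW α) α)) where
  toFun s := extendTwo (addLine W) (s, coneRadius t)
  continuous_toFun := continuous_extendTwo_addLine.comp (continuous_id.prodMk continuous_const)
  map_pt := extendTwo_infty_left _ _
  map_act g s := by
    change extendTwo (addLine W) (OnePoint.map (tensorRep ρW α g) s, coneRadius t) =
      OnePoint.map (tensorRep (sumRep ρW α) α g) (extendTwo (addLine W) (s, coneRadius t))
    induction s using OnePoint.rec with
    | infty =>
      rw [OnePoint.map_infty, extendTwo_infty_left, OnePoint.map_infty]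
    | coe w =>
      generalize coneRadius t = r
      induction r using OnePoint.rec with
      | infty => rw [extendTwo_infty_right, extendTwo_infty_right, OnePoint.map_infty]
      | coe r => exact congrArg OnePoint.some (addLine_act ρW α g w r)

end Cone

/-! ### Pairs over the standard inclusion -/

section Sphere

variable {U W : Type*}
  [NormedAddCommGroup U] [InnerProductSpace ℝ U]
  [NormedAddCommGroup W] [InnerProductSpace ℝ W]

lemma exists_fibreIncl_eq {q : Complement W U (WithLp 2 (U × ℝ))} (hq : q.1.1 = sumInl U ℝ) :
    ∃ x, fibreIncl W U ℝ x = q := by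
  obtain ⟨⟨f, z⟩, hf, hz⟩ := q
  obtain rfl : f = sumInl U ℝ := hq
  have hle : (LinearMap.range (sumInl U ℝ).toLinearMap)ᗮ ≤
      LinearMap.range (sumInr U ℝ).toLinearMap := by
    intro v hv
    have h := hv (sumInl U ℝ v.fst) ⟨v.fst, rfl⟩
    have h1 : ⟪sumInl U ℝ v.fst, v⟫_ℝ = ⟪v.fst, v.fst⟫_ℝ + ⟪(0 : ℝ), v.snd⟫_ℝ :=
      WithLp.prod_inner_apply _ _
    rw [h, inner_zero_left, add_zero, eq_comm, inner_self_eq_zero] at h1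
    refine ⟨v.snd, ?_⟩
    change WithLp.toLp 2 ((0 : U), v.snd) = v
    rw [← h1]
    rfl
  obtain ⟨y, hy⟩ := tensorSub_mono (W := W) hle hz
  let e := LinearEquiv.ofInjective (sumInr U ℝ).toLinearMap (sumInr U ℝ).injective
  refine ⟨e.symm.toLinearMap.lTensor W y, Subtype.ext (Prod.ext rfl ?_)⟩
  change (sumInr U ℝ).toLinearMap.lTensor W (e.symm.toLinearMap.lTensor W y) = z
  refine Eq.trans ?_ hy
  rw [← LinearMap.comp_apply, ← LinearMap.lTensor_comp]
  congr 2
  ext v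
  exact congrArg Subtype.val (e.apply_symm_apply v)

variable [FiniteDimensional ℝ W]

lemma range_sphereIncl_eq_insert (ρU : OrthRep U) (ρW : OrthRep W) (α : OrthRep ℝ) :
    Set.range (sphereIncl ρW ρU α).toFun =
      insert (Jet ρW ρU (sumRep ρU α)).pt (pairsOverIncl ρW ρU α) := by
  ext p
  constructor
  · rintro ⟨s, rfl⟩
    change OnePoint (W ⊗[ℝ] ℝ) at s
    induction s using OnePoint.rec with
    | infty => exact Or.inl rfl
    | coe x => exact Or.inr ⟨fibreIncl W U ℝ x, rfl, rfl⟩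
  · rintro (rfl | ⟨q, hq, rfl⟩)
    · exact ⟨OnePoint.infty, rfl⟩
    · obtain ⟨x, rfl⟩ := exists_fibreIncl_eq hq
      exact ⟨OnePoint.some x, rfl⟩

variable [FiniteDimensional ℝ U]

lemma isClosedEmbedding_sphereIncl (ρU : OrthRep U) (ρW : OrthRep W) (α : OrthRep ℝ) :
    Topology.IsClosedEmbedding (sphereIncl ρW ρU α).toFun := by
  have : CompactSpace (repSphere (tensorRep ρW α)) :=
    inferInstanceAs (CompactSpace (OnePoint (W ⊗[ℝ] ℝ)))
  have : T2Space (Jet ρW ρU (sumRep ρU α)) :=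
    inferInstanceAs (T2Space (OnePoint (Complement W U (WithLp 2 (U × ℝ)))))
  exact (sphereIncl ρW ρU α).continuous_toFun.isClosedEmbedding
    (Option.map_injective isometry_fibreIncl.injective)

lemma closure_pairsOverIncl_subset (ρU : OrthRep U) (ρW : OrthRep W) (α : OrthRep ℝ) :
    closure (pairsOverIncl ρW ρU α) ⊆ Set.range (sphereIncl ρW ρU α).toFun :=
  closure_minimal (range_sphereIncl_eq_insert ρU ρW α ▸ Set.subset_insert _ _)
    (isClosedEmbedding_sphereIncl ρU ρW α).isClosed_range

lemma range_sphereIncl (ρU : OrthRep U) (ρW : OrthRep W) (α : OrthRep ℝ) :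
    Set.range (sphereIncl ρW ρU α).toFun =
      insert (Jet ρW ρU (sumRep ρU α)).pt (closure (pairsOverIncl ρW ρU α)) := by
  refine Set.Subset.antisymm ?_ (Set.insert_subset ?_ (closure_pairsOverIncl_subset ρU ρW α))
  · rw [range_sphereIncl_eq_insert]
    exact Set.insert_subset_insert subset_closure
  · exact range_sphereIncl_eq_insert ρU ρW α ▸ Set.mem_insert _ _

/-- If `W ≠ 0` then `W ⊗ ℝ` is not compact, so that `∞` is a limit of pairs over the inclusion. -/
lemma range_sphereIncl_of_nontrivial [Nontrivial W] (ρU : OrthRep U) (ρW : OrthRep W)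
    (α : OrthRep ℝ) :
    Set.range (sphereIncl ρW ρU α).toFun = closure (pairsOverIncl ρW ρU α) := by
  refine Set.Subset.antisymm ?_ (closure_pairsOverIncl_subset ρU ρW α)
  have : Nontrivial (W ⊗[ℝ] ℝ) := (TensorProduct.rid ℝ W).toEquiv.nontrivial
  have : NoncompactSpace (W ⊗[ℝ] ℝ) := NormedSpace.noncompactSpace ℝ _
  refine ((sphereIncl ρW ρU α).continuous_toFun.range_subset_closure_image_dense
    (OnePoint.denseRange_coe (X := W ⊗[ℝ] ℝ))).trans (closure_mono ?_)
  rintro _ ⟨_, ⟨x, rfl⟩, rfl⟩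
  exact ⟨fibreIncl W U ℝ x, rfl, rfl⟩

end Sphere

/-! ### Polar coordinates on the complement bundle of `W ⊕ ℝ` -/

section Polar

variable {U V W : Type*}
  [NormedAddCommGroup U] [InnerProductSpace ℝ U]
  [NormedAddCommGroup V] [InnerProductSpace ℝ V]
  [NormedAddCommGroup W] [InnerProductSpace ℝ W]

/-- The composite of `(f, y)` with `(i, (w, r))`. Its coordinates are the isometry `f ∘ i`, the
vector `y + f(w)` of `W ⊗ f(U)ᗮ` and the vector `r f(0, 1)` of `f(U)ᗮ`; the latter has length `|r|`
and determines the extension `f` of `f ∘ i` as long as `r > 0`. -/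
noncomputable def polar (a : Complement W (WithLp 2 (U × ℝ)) V) (w : W ⊗[ℝ] ℝ) (r : ℝ) :
    Complement (WithLp 2 (W × ℝ)) U V :=
  complementComp (complementIncl a, fibreIncl (WithLp 2 (W × ℝ)) U ℝ (addLine W (w, r)))

lemma polar_map (a : Complement W (WithLp 2 (U × ℝ)) V) (w : W ⊗[ℝ] ℝ) (r : ℝ) :
    (polar a w r).1.1 = a.1.1 ∘L sumInl U ℝ := rfl

lemma polar_vector (a : Complement W (WithLp 2 (U × ℝ)) V) (w : W ⊗[ℝ] ℝ) (r : ℝ) :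
    (polar a w r).1.2 = tensorInl W V a.1.2 + a.1.1.toLinearMap.lTensor _
      ((sumInr U ℝ).toLinearMap.lTensor _ (addLine W (w, r))) := rfl

lemma tensorFst_polar (a : Complement W (WithLp 2 (U × ℝ)) V) (w : W ⊗[ℝ] ℝ) (r : ℝ) :
    tensorFst W V (polar a w r).1.2 = a.1.2 + a.1.1.toLinearMap.lTensor W
      ((sumInr U ℝ).toLinearMap.lTensor W w) := by
  rw [polar_vector, map_add, tensorFst_tensorInl, tensorFst_lTensor, tensorFst_lTensor,
    tensorFst_addLine]

lemma tensorSnd_polar (a : Complement W (WithLp 2 (U × ℝ)) V) (w : W ⊗[ℝ] ℝ) (r : ℝ) :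
    tensorSnd W V (polar a w r).1.2 = a.1.1 (sumInr U ℝ r) := by
  rw [polar_vector, map_add, tensorSnd_tensorInl, tensorSnd_lTensor, tensorSnd_lTensor,
    tensorSnd_addLine, zero_add]
  rfl

lemma norm_tensorSnd_polar (a : Complement W (WithLp 2 (U × ℝ)) V) (w : W ⊗[ℝ] ℝ) (r : ℝ) :
    ‖tensorSnd W V (polar a w r).1.2‖ = |r| := by
  rw [tensorSnd_polar, a.2.1, LinearIsometry.norm_map, Real.norm_eq_abs]

/-- At radius zero the composite is the composite for `W`, included into the bundle for `W ⊕ ℝ`: this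
is the gluing condition at the end of the cone. -/
lemma polar_zero (a : Complement W (WithLp 2 (U × ℝ)) V) (w : W ⊗[ℝ] ℝ) :
    polar a w 0 = complementIncl (complementComp (a, fibreIncl W U ℝ w)) := by
  refine Subtype.ext (Prod.ext rfl (tensor_ext ?_ ?_))
  · rw [tensorFst_polar]
    exact (tensorFst_tensorInl _).symm
  · rw [tensorSnd_polar, map_zero, map_zero]
    exact (tensorSnd_tensorInl _).symm

lemma polar_injective {a a' : Complement W (WithLp 2 (U × ℝ)) V} {w w' : W ⊗[ℝ] ℝ} {r r' : ℝ}
    (hr : 0 < r) (hr' : 0 < r') (h : polar a w r = polar a' w' r') :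
    a = a' ∧ w = w' ∧ r = r' := by
  have hrr : r = r' := by
    have := congrArg (fun q : Complement _ U V => ‖tensorSnd W V q.1.2‖) h
    simpa only [norm_tensorSnd_polar, abs_of_pos hr, abs_of_pos hr'] using this
  subst hrr
  have h1 := congrArg (fun q : Complement _ U V => q.1.1) h
  have h2 := congrArg (fun q : Complement _ U V => tensorFst W V q.1.2) h
  have h3 := congrArg (fun q : Complement _ U V => tensorSnd W V q.1.2) h
  simp only [polar_map, tensorFst_polar, tensorSnd_polar] at h1 h2 h3
  obtain ⟨⟨f, y⟩, hf, hy⟩ := a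
  obtain ⟨⟨f', y'⟩, hf', hy'⟩ := a'
  have hff : f = f' := by
    ext v
    have hv : v = sumInl U ℝ v.fst + (v.snd * r⁻¹) • sumInr U ℝ r := by
      rw [← map_smul, smul_eq_mul, inv_mul_cancel_right₀ hr.ne']
      change v = WithLp.toLp 2 (v.fst + 0, 0 + v.snd)
      rw [add_zero, zero_add]
      rfl
    have h1' : f (sumInl U ℝ v.fst) = f' (sumInl U ℝ v.fst) := DFunLike.congr_fun h1 v.fst
    have h3' : f (sumInr U ℝ r) = f' (sumInr U ℝ r) := h3
    rw [hv, map_add, map_add, map_smul, map_smul, h1', h3']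
  subst hff
  -- `y + f(w) = y' + f(w')` splits into its components along `W ⊗ f(U ⊕ ℝ)` and its complement
  let φ := (LinearIsometry.mk f.toLinearMap hf).lTensor W
  let ψ := (sumInr U ℝ).lTensor W
  have h4 : φ (ψ (w - w')) = y' - y := by
    have h2' : y + φ (ψ w) = y' + φ (ψ w') := h2
    rw [map_sub, map_sub, sub_eq_sub_iff_add_eq_add, add_comm, h2', add_comm]
  have h5 : ⟪φ (ψ (w - w')), y' - y⟫_ℝ = 0 := by
    refine inner_tensorSub_orthogonal (K := LinearMap.range f.toLinearMap) ?_ (sub_mem hy' hy)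
    generalize ψ (w - w') = z
    induction z using TensorProduct.induction_on with
    | zero => simp
    | tmul w v => exact tmul_mem_tensorSub w ⟨v, rfl⟩
    | add x y hx hy => rw [map_add]; exact add_mem hx hy
  rw [h4, inner_self_eq_zero] at h5
  rw [h5] at h4
  refine ⟨Subtype.ext (Prod.ext rfl (sub_eq_zero.1 h5).symm), sub_eq_zero.1 ?_, rfl⟩
  exact (φ.comp ψ).injective (h4.trans (map_zero _).symm)

/-- A pair with a nonzero coordinate `v` in `f(U)ᗮ` comes from the extension of `f` to `U ⊕ ℝ` that
sends `(0, 1)` to `v / ‖v‖`. -/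
lemma exists_polar_eq {q : Complement (WithLp 2 (W × ℝ)) U V}
    (hq : tensorSnd W V q.1.2 ≠ 0) : ∃ a w r, 0 < r ∧ polar a w r = q := by
  obtain ⟨⟨f, z⟩, hf, hz⟩ := q
  set v := tensorSnd W V z with hv
  have hvp : 0 < ‖v‖ := norm_pos_iff.2 hq
  set n : V := ‖v‖⁻¹ • v with hn
  have hn1 : ‖n‖ = 1 := by rw [hn, norm_smul, norm_inv, norm_norm, inv_mul_cancel₀ hvp.ne']
  have hnf : ∀ u, ⟪f u, n⟫_ℝ = 0 := fun u =>
    Submodule.smul_mem _ _ (tensorSnd_mem hz) (f u) ⟨u, rfl⟩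
  let F : WithLp 2 (U × ℝ) →L[ℝ] V :=
    f ∘L WithLp.fstL 2 ℝ U ℝ + (WithLp.sndL 2 ℝ U ℝ).smulRight n
  have hF : ∀ p, F p = f p.fst + p.snd • n := fun p => rfl
  have hF1 : ∀ p, ‖F p‖ = ‖p‖ := by
    intro p
    rw [← sq_eq_sq₀ (norm_nonneg _) (norm_nonneg _), hF, norm_add_sq_real, inner_smul_right, hnf,
      norm_smul, hn1, hf, WithLp.prod_norm_sq_eq_of_L2]
    simp
  -- `x = y + w ⊗ n`, where `w` is the contraction of `x` against the unit vector `n = v / ‖v‖`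
  have hxm : tensorFst W V z ∈ tensorSub W (LinearMap.range f.toLinearMap)ᗮ := tensorFst_mem hz
  obtain ⟨x, hx⟩ : ∃ x, x = tensorFst W V z := ⟨_, rfl⟩
  rw [← hx] at hxm
  let φ : V →ₗ[ℝ] ℝ := (innerSL ℝ n).toLinearMap
  let w := φ.lTensor W x
  let P : V →ₗ[ℝ] V := LinearMap.id - (LinearMap.toSpanSingleton ℝ V n) ∘ₗ φ
  have hP : ∀ k, P k = k - ⟪n, k⟫_ℝ • n := fun k => rfl
  let y := P.lTensor W x
  have hy : y ∈ tensorSub W (LinearMap.range F.toLinearMap)ᗮ := by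
    refine map_mem_tensorSub (A := LinearMap.id) (B := P) ?_ hxm
    rintro k hk _ ⟨p, rfl⟩
    change ⟪F p, P k⟫_ℝ = 0
    have hk' : ⟪f p.fst, k⟫_ℝ = 0 := hk _ ⟨_, rfl⟩
    rw [hF, hP, inner_sub_right, inner_add_left, inner_smul_right, inner_add_left, hk', hnf,
      real_inner_smul_left n k p.snd, real_inner_smul_left n n p.snd,
      real_inner_self_eq_norm_sq, hn1]
    simp [mul_comm]
  refine ⟨⟨(F, y), hF1, hy⟩, w, ‖v‖, hvp, Subtype.ext (Prod.ext ?_ (tensor_ext ?_ ?_))⟩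
  · ext u
    change f u + (0 : ℝ) • n = f u
    rw [zero_smul, add_zero]
  · refine ((tensorFst_polar _ _ _).trans ?_).trans hx
    change P.lTensor W x + F.toLinearMap.lTensor W
      ((sumInr U ℝ).toLinearMap.lTensor W (φ.lTensor W x)) = x
    rw [← LinearMap.comp_apply, ← LinearMap.comp_apply, ← LinearMap.lTensor_comp,
      ← LinearMap.lTensor_comp, ← LinearMap.add_apply, ← LinearMap.lTensor_add]
    have : P + F.toLinearMap ∘ₗ (sumInr U ℝ).toLinearMap ∘ₗ φ = LinearMap.id := by
      ext k
      change P k + (f 0 + ⟪n, k⟫_ℝ • n) = k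
      rw [hP, map_zero, zero_add, sub_add_cancel]
    rw [LinearMap.comp_assoc, this, LinearMap.lTensor_id, LinearMap.id_apply]
  · rw [tensorSnd_polar]
    change f 0 + ‖v‖ • n = v
    rw [map_zero, zero_add, hn, smul_inv_smul₀ hvp.ne']

end Polar

/-! ### The homotopy cofibre -/

section Cofibre

variable {U V W : Type*}
  [NormedAddCommGroup U] [InnerProductSpace ℝ U]
  [NormedAddCommGroup V] [InnerProductSpace ℝ V]
  [NormedAddCommGroup W] [InnerProductSpace ℝ W]
  (ρU : OrthRep U) (ρV : OrthRep V) (ρW : OrthRep W) (α : OrthRep ℝ)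

/-- A point of the smash product is the base point or a pair of finite points. -/
lemma smash_cases (x : smash (Jet ρW (sumRep ρU α) ρV) (repSphere (tensorRep ρW α))) :
    x = (smash (Jet ρW (sumRep ρU α) ρV) (repSphere (tensorRep ρW α))).pt ∨
      ∃ (a : Complement W (WithLp 2 (U × ℝ)) V) (w : W ⊗[ℝ] ℝ),
        x = Quot.mk _ (OnePoint.some a, OnePoint.some w) := by
  induction x using Quot.ind with | _ p =>
  obtain ⟨a, s⟩ := p
  change OnePoint (Complement W (WithLp 2 (U × ℝ)) V) at a
  change OnePoint (W ⊗[ℝ] ℝ) at s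
  induction a using OnePoint.rec with
  | infty => exact Or.inl (Quot.sound ⟨Or.inl rfl, Or.inl rfl⟩)
  | coe a =>
    induction s using OnePoint.rec with
    | infty => exact Or.inl (Quot.sound ⟨Or.inr rfl, Or.inl rfl⟩)
    | coe w => exact Or.inr ⟨a, w, rfl⟩

variable [FiniteDimensional ℝ U] [FiniteDimensional ℝ V] [FiniteDimensional ℝ W]

/-- The map `J_W(U ⊕ ℝ^α, V) ∧ S^{W ⊗ ℝ^α} → J_{W ⊕ ℝ^α}(U, V)` at level `t` of the cone: the
restricted composition map for `W ⊕ ℝ^α`, where the sphere is included at height `(1 - t) / t`. -/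
noncomputable def coneLevel (t : I) :
    PtdC2Hom (smash (Jet ρW (sumRep ρU α) ρV) (repSphere (tensorRep ρW α)))
      (Jet (sumRep ρW α) ρU ρV) :=
  (restrictedComp (sumRep ρW α) ρU α ρV).comp
    (smashMap (jetIncl ρW (sumRep ρU α) ρV α) (coneSphere ρW α t))

lemma coneLevel_coe {t : I} (ht : t ≠ 0) (a : Complement W (WithLp 2 (U × ℝ)) V) (w : W ⊗[ℝ] ℝ) :
    (coneLevel ρU ρV ρW α t).toFun (Quot.mk _ (OnePoint.some a, OnePoint.some w)) =
      OnePoint.some (polar a w ((1 - (t : ℝ)) / t)) := by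
  change extendTwo complementComp (OnePoint.some (complementIncl a),
    OnePoint.map (fibreIncl _ U ℝ) (extendTwo (addLine W) (OnePoint.some w, coneRadius t))) = _
  rw [coneRadius_of_ne ht]
  rfl

lemma coneLevel_zero (x : smash (Jet ρW (sumRep ρU α) ρV) (repSphere (tensorRep ρW α))) :
    (coneLevel ρU ρV ρW α 0).toFun x = (Jet (sumRep ρW α) ρU ρV).pt := by
  obtain rfl | ⟨a, w, rfl⟩ := smash_cases ρU ρV ρW α x
  · exact (coneLevel ρU ρV ρW α 0).map_pt
  · change extendTwo complementComp (OnePoint.some (complementIncl a),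
      OnePoint.map (fibreIncl _ U ℝ) (extendTwo (addLine W) (OnePoint.some w, coneRadius 0))) = _
    rw [coneRadius_zero]
    rfl

lemma coneLevel_one (x : smash (Jet ρW (sumRep ρU α) ρV) (repSphere (tensorRep ρW α))) :
    (coneLevel ρU ρV ρW α 1).toFun x =
      (jetIncl ρW ρU ρV α).toFun ((restrictedComp ρW ρU α ρV).toFun x) := by
  obtain rfl | ⟨a, w, rfl⟩ := smash_cases ρU ρV ρW α x
  · rw [PtdC2Hom.map_pt, PtdC2Hom.map_pt, PtdC2Hom.map_pt]
  · refine (coneLevel_coe ρU ρV ρW α one_ne_zero a w).trans ?_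
    have : (1 - ((1 : I) : ℝ)) / (1 : I) = 0 := by simp
    rw [this, polar_zero]
    rfl

lemma continuous_coneLevel :
    Continuous fun p : smash (Jet ρW (sumRep ρU α) ρV) (repSphere (tensorRep ρW α)) × I =>
      (coneLevel ρU ρV ρW α p.2).toFun p.1 := by
  refine Topology.IsQuotientMap.continuous_lift_prod_left (f := Quot.mk _) isQuotientMap_quot_mk ?_
  have h : Continuous fun p : (Jet ρW (sumRep ρU α) ρV × repSphere (tensorRep ρW α)) × I =>
      ((jetIncl ρW (sumRep ρU α) ρV α).toFun p.1.1,
        (extendTwo (addLine W) (p.1.2, coneRadius p.2) :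
          repSphere (tensorRep (sumRep ρW α) α))) := by
    refine ((jetIncl ρW (sumRep ρU α) ρV α).continuous_toFun.comp
      (continuous_fst.comp continuous_fst)).prodMk (continuous_extendTwo_addLine.comp ?_)
    exact (continuous_snd.comp continuous_fst).prodMk (continuous_coneRadius.comp continuous_snd)
  exact (restrictedComp (sumRep ρW α) ρU α ρV).continuous_toFun.comp (continuous_quot_mk.comp h)

/-- The comparison map from the homotopy cofibre to `J_{W ⊕ ℝ^α}(U, V)`. -/
noncomputable def cofibreMap :
    PtdC2Hom (homotopyCofibre (restrictedComp ρW ρU α ρV)) (Jet (sumRep ρW α) ρU ρV) where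
  toFun := Quot.lift (Sum.elim (jetIncl ρW ρU ρV α).toFun
    fun p => (coneLevel ρU ρV ρW α p.2).toFun p.1) fun p q h => by
      cases h with
      | cone x => exact (coneLevel_zero ρU ρV ρW α x).trans (PtdC2Hom.map_pt _).symm
      | base t => exact (PtdC2Hom.map_pt _).trans (PtdC2Hom.map_pt _).symm
      | glue x => exact coneLevel_one ρU ρV ρW α x
  continuous_toFun := continuous_quot_lift _ <|
    (jetIncl ρW ρU ρV α).continuous_toFun.sumElim (continuous_coneLevel ρU ρV ρW α)
  map_pt := (jetIncl ρW ρU ρV α).map_pt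
  map_act g x := by
    induction x using Quot.ind with | _ p =>
    rcases p with y | ⟨x, t⟩
    · exact (jetIncl ρW ρU ρV α).map_act g y
    · exact (coneLevel ρU ρV ρW α t).map_act g x

/-- A point of the homotopy cofibre comes from `J_W(U, V)` or from the open cone on the finite
points of the smash product. -/
lemma homotopyCofibre_cases (x : homotopyCofibre (restrictedComp ρW ρU α ρV)) :
    (∃ y, x = Quot.mk _ (Sum.inl y)) ∨
      ∃ (a : Complement W (WithLp 2 (U × ℝ)) V) (w : W ⊗[ℝ] ℝ) (t : I), t ≠ 0 ∧ t ≠ 1 ∧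
        x = Quot.mk _ (Sum.inr (Quot.mk _ (OnePoint.some a, OnePoint.some w), t)) := by
  induction x using Quot.ind with | _ p =>
  rcases p with y | ⟨x, t⟩
  · exact Or.inl ⟨y, rfl⟩
  by_cases h0 : t = 0
  · subst h0
    exact Or.inl ⟨_, Quot.sound (ConeRel.cone x)⟩
  by_cases h1 : t = 1
  · subst h1
    exact Or.inl ⟨_, Quot.sound (ConeRel.glue x)⟩
  obtain rfl | ⟨a, w, rfl⟩ := smash_cases ρU ρV ρW α x
  · exact Or.inl ⟨_, Quot.sound (ConeRel.base t)⟩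
  · exact Or.inr ⟨a, w, t, h0, h1, rfl⟩

lemma one_sub_div_pos {t : I} (h0 : t ≠ 0) (h1 : t ≠ 1) : 0 < (1 - (t : ℝ)) / t :=
  div_pos (sub_pos.2 (unitInterval.lt_one_iff_ne_one.2 h1)) (unitInterval.pos_iff_ne_zero.2 h0)

lemma jetIncl_ne_polar (y : Jet ρW ρU ρV) (a : Complement W (WithLp 2 (U × ℝ)) V) (w : W ⊗[ℝ] ℝ)
    {r : ℝ} (hr : 0 < r) : (jetIncl ρW ρU ρV α).toFun y ≠ OnePoint.some (polar a w r) := by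
  intro h
  change OnePoint (Complement W U V) at y
  induction y using OnePoint.rec with
  | infty => exact OnePoint.infty_ne_coe _ h
  | coe p =>
    have h' : complementIncl p = polar a w r := OnePoint.coe_injective h
    have h2 := norm_tensorSnd_polar a w r
    rw [← h', abs_of_pos hr] at h2
    change ‖tensorSnd W V (tensorInl W V p.1.2)‖ = r at h2
    rw [tensorSnd_tensorInl, norm_zero] at h2
    exact hr.ne h2

lemma cofibreMap_injective : Function.Injective (cofibreMap ρU ρV ρW α).toFun := by
  intro x x' h
  obtain ⟨y, rfl⟩ | ⟨a, w, t, h0, h1, rfl⟩ := homotopyCofibre_cases ρU ρV ρW α x <;>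
    obtain ⟨y', rfl⟩ | ⟨a', w', t', h0', h1', rfl⟩ := homotopyCofibre_cases ρU ρV ρW α x'
  · have : y = y' := Option.map_injective isometry_complementIncl.injective h
    rw [this]
  · exact absurd (h.trans (coneLevel_coe ρU ρV ρW α h0' a' w'))
      (jetIncl_ne_polar ρU ρV ρW α y a' w' (one_sub_div_pos h0' h1'))
  · exact absurd (h.symm.trans (coneLevel_coe ρU ρV ρW α h0 a w))
      (jetIncl_ne_polar ρU ρV ρW α y' a w (one_sub_div_pos h0 h1))
  · have h2 := ((coneLevel_coe ρU ρV ρW α h0 a w).symm.trans h).trans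
      (coneLevel_coe ρU ρV ρW α h0' a' w')
    obtain ⟨rfl, rfl, h3⟩ := polar_injective (one_sub_div_pos h0 h1) (one_sub_div_pos h0' h1')
      (OnePoint.coe_injective h2)
    have ht : (t : ℝ) ≠ 0 := fun h => h0 (Subtype.ext h)
    have ht' : (t' : ℝ) ≠ 0 := fun h => h0' (Subtype.ext h)
    have : t = t' := by
      rw [div_eq_div_iff ht ht'] at h3
      exact Subtype.ext (by linarith)
    rw [this]

lemma cofibreMap_surjective : Function.Surjective (cofibreMap ρU ρV ρW α).toFun := by
  intro q
  change OnePoint (Complement (WithLp 2 (W × ℝ)) U V) at q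
  induction q using OnePoint.rec with
  | infty => exact ⟨_, (cofibreMap ρU ρV ρW α).map_pt⟩
  | coe q =>
    by_cases hq : tensorSnd W V q.1.2 = 0
    · obtain ⟨p, rfl⟩ := exists_complementIncl_eq hq
      exact ⟨Quot.mk _ (Sum.inl (OnePoint.some p)), rfl⟩
    · obtain ⟨a, w, r, hr, rfl⟩ := exists_polar_eq hq
      -- the solution of `(1 - t) / t = r`
      let t : I := ⟨(1 + r)⁻¹, by positivity, inv_le_one_of_one_le₀ (by linarith)⟩
      have ht : t ≠ 0 := fun h => (inv_pos.2 (add_pos one_pos hr)).ne' (congrArg Subtype.val h)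
      have htr : (1 - (t : ℝ)) / t = r := by
        change (1 - (1 + r)⁻¹) / (1 + r)⁻¹ = r
        field_simp
        ring
      refine ⟨Quot.mk _ (Sum.inr (Quot.mk _ (OnePoint.some a, OnePoint.some w), t)), ?_⟩
      exact (coneLevel_coe ρU ρV ρW α ht a w).trans (by rw [htr])

/-- The comparison map is a homeomorphism, being a continuous bijection from a compact
space to a Hausdorff space. -/
noncomputable def cofibreHomeo :
    PtdC2Homeo (homotopyCofibre (restrictedComp ρW ρU α ρV)) (Jet (sumRep ρW α) ρU ρV) :=
  have : T2Space (Jet (sumRep ρW α) ρU ρV) :=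
    inferInstanceAs (T2Space (OnePoint (Complement (WithLp 2 (W × ℝ)) U V)))
  have : CompactSpace (Jet ρW ρU ρV) :=
    inferInstanceAs (CompactSpace (OnePoint (Complement W U V)))
  have : CompactSpace (Jet ρW (sumRep ρU α) ρV) :=
    inferInstanceAs (CompactSpace (OnePoint (Complement W (WithLp 2 (U × ℝ)) V)))
  have : CompactSpace (repSphere (tensorRep ρW α)) :=
    inferInstanceAs (CompactSpace (OnePoint (W ⊗[ℝ] ℝ)))
  have : CompactSpace (smash (Jet ρW (sumRep ρU α) ρV) (repSphere (tensorRep ρW α))) :=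
    Quot.compactSpace
  have : CompactSpace (homotopyCofibre (restrictedComp ρW ρU α ρV)) := Quot.compactSpace
  { Continuous.homeoOfEquivCompactToT2
      (f := Equiv.ofBijective (cofibreMap ρU ρV ρW α).toFun
        ⟨cofibreMap_injective ρU ρV ρW α, cofibreMap_surjective ρU ρV ρW α⟩)
      (cofibreMap ρU ρV ρW α).continuous_toFun with
    map_pt := (cofibreMap ρU ρV ρW α).map_pt
    map_act := (cofibreMap ρU ρV ρW α).map_act }

end Cofibre

end C2Calculus

theorem proposition2p6 {U V W : Type*}
    [NormedAddCommGroup U] [InnerProductSpace ℝ U] [FiniteDimensional ℝ U]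
    [NormedAddCommGroup V] [InnerProductSpace ℝ V] [FiniteDimensional ℝ V]
    [NormedAddCommGroup W] [InnerProductSpace ℝ W] [FiniteDimensional ℝ W]
    (ρU : OrthRep U) (ρV : OrthRep V) (ρW : OrthRep W)
    (α : OrthRep ℝ) (hα : α = trivialLine ∨ α = signLine) :
    -- the sphere is identified with the closure of the pairs `(i, x)`, with `∞` added if `W = 0`
    (Topology.IsEmbedding (sphereIncl ρW ρU α).toFun ∧
      Set.range (sphereIncl ρW ρU α).toFun =
        insert (Jet ρW ρU (sumRep ρU α)).pt (closure (pairsOverIncl ρW ρU α)) ∧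
      (Nontrivial W →
        Set.range (sphereIncl ρW ρU α).toFun = closure (pairsOverIncl ρW ρU α))) ∧
    -- the homotopy cofibre of `J_W(U ⊕ ℝ^α, V) ∧ S^(W ⊗ ℝ^α) → J_W(U, V)` is `J_(W ⊕ ℝ^α)(U, V)`
    Nonempty (PtdC2Homeo (homotopyCofibre (restrictedComp ρW ρU α ρV))
      (Jet (sumRep ρW α) ρU ρV)) := by
  refine ⟨⟨(isClosedEmbedding_sphereIncl ρU ρW α).isEmbedding, range_sphereIncl ρU ρW α,
    fun _ => range_sphereIncl_of_nontrivial ρU ρW α⟩, ⟨cofibreHomeo ρU ρV ρW α⟩⟩
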